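/- Let $\Bbbk$ be a field of characteristic zero and let $(R,\mathfrak m)$ be a commutative Noetherian local ring that is a $\Bbbk$-algebra. Let $1\le m\le n$, and for an ideal $J\subseteq R$ let $\mathrm{Mat}(m,n;J)$ be the set of $m\times n$ matrices with all entries in $J$. Let $G_{lr}=GL(m,R)\times GL(n,R)$ act on $m\times n$ matrices over $R$ by $A\mapsto UAV^{-1}$, and let $G_l=GL(m,R)\times\{1\}$ and $G_r=\{1\}\times GL(n,R)$ be its subgroups of left and right multiplications. For a subgroup $G\subseteq G_{lr}$, a matrix $A$ is called finitely $G$-determined if there is $k\in\mathbb N$ such that for every $B\in \mathrm{Mat}(m,n;\mathfrak m^{k+1})$ the matrix $A+B$ lies in the $G$-orbit of $A$. Let $I_m(A)\subseteq R$ be the ideal generated by all $m\times m$ minors of $A$. Then: 1. If $\dim R>0$ (Krull dimension) and $m<n$, then no $A\in \mathrm{Mat}(m,n;\mathfrak m)$ is finitely $G_l$-determined. 2. A matrix $A\in \mathrm{Mat}(m,n;\mathfrak m)$ is finitely $G_{lr}$-determined if and only if it is finitely $G_r$-determined. 3. A matrix $A\in \mathrm{Mat}(m,n;\mathfrak m)$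 is finitely $G_r$-determined if and only if $I_m(A)$ contains a power of $\mathfrak m$. -/

import Mathlib

namespace FiniteDeterminacy

/-- The matrices of size `m × n` all of whose entries lie in the ideal `I`. -/
def matOver {R : Type*} [CommRing R] (m n : ℕ) (I : Ideal R) :
    Set (Matrix (Fin m) (Fin n) R) :=
  {A | ∀ i j, A i j ∈ I}

/-- The action of `GL(m,R) × GL(n,R)` on `m × n` matrices, `(U, V) • A = U A V⁻¹`
(the inverse makes it a left action; the orbits are those of `A ↦ U A V`). -/
instance twoSidedAction {R : Type*} [CommRing R] (m n : ℕ) :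
    MulAction (Matrix.GeneralLinearGroup (Fin m) R × Matrix.GeneralLinearGroup (Fin n) R)
      (Matrix (Fin m) (Fin n) R) where
  smul g A := (g.1 : Matrix (Fin m) (Fin m) R) * A *
    ((g.2⁻¹ : Matrix.GeneralLinearGroup (Fin n) R) : Matrix (Fin n) (Fin n) R)
  one_smul A := by
    change ((1 : Matrix.GeneralLinearGroup (Fin m) R) : Matrix (Fin m) (Fin m) R) * A *
      (((1 : Matrix.GeneralLinearGroup (Fin n) R)⁻¹ : Matrix.GeneralLinearGroup (Fin n) R) :
        Matrix (Fin n) (Fin n) R) = A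
    simp
  mul_smul g h A := by
    change ((g.1 * h.1 : Matrix.GeneralLinearGroup (Fin m) R) : Matrix (Fin m) (Fin m) R) * A *
      (((g.2 * h.2)⁻¹ : Matrix.GeneralLinearGroup (Fin n) R) : Matrix (Fin n) (Fin n) R) =
      (g.1 : Matrix (Fin m) (Fin m) R) * ((h.1 : Matrix (Fin m) (Fin m) R) * A *
        ((h.2⁻¹ : Matrix.GeneralLinearGroup (Fin n) R) : Matrix (Fin n) (Fin n) R)) *
        ((g.2⁻¹ : Matrix.GeneralLinearGroup (Fin n) R) : Matrix (Fin n) (Fin n) R)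
    rw [mul_inv_rev, Units.val_mul, Units.val_mul]
    simp only [Matrix.mul_assoc]

/-- The group `G_lr` of two-sided multiplications. -/
def Glr (R : Type*) [CommRing R] (m n : ℕ) :
    Subgroup (Matrix.GeneralLinearGroup (Fin m) R × Matrix.GeneralLinearGroup (Fin n) R) :=
  ⊤

/-- The group `G_l` of left multiplications, the subgroup `GL(m,R) × {1}` of `G_lr`. -/
def Gl (R : Type*) [CommRing R] (m n : ℕ) :
    Subgroup (Matrix.GeneralLinearGroup (Fin m) R × Matrix.GeneralLinearGroup (Fin n) R) :=
  Subgroup.prod ⊤ ⊥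

/-- The group `G_r` of right multiplications, the subgroup `{1} × GL(n,R)` of `G_lr`. -/
def Gr (R : Type*) [CommRing R] (m n : ℕ) :
    Subgroup (Matrix.GeneralLinearGroup (Fin m) R × Matrix.GeneralLinearGroup (Fin n) R) :=
  Subgroup.prod ⊥ ⊤

/-- `A` is `G`-`k`-determined: `A + B` lies in the `G`-orbit of `A` for every matrix `B` with
entries in the `(k+1)`-st power of the maximal ideal. -/
def IsDetermined {R : Type*} [CommRing R] [IsLocalRing R] {m n : ℕ}
    (G : Subgroup
      (Matrix.GeneralLinearGroup (Fin m) R × Matrix.GeneralLinearGroup (Fin n) R))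
    (k : ℕ) (A : Matrix (Fin m) (Fin n) R) : Prop :=
  ∀ B ∈ matOver m n (IsLocalRing.maximalIdeal R ^ (k + 1)), A + B ∈ MulAction.orbit G A

/-- `A` is finitely `G`-determined: it is `G`-`k`-determined for some natural number `k`. -/
def IsFinitelyDetermined {R : Type*} [CommRing R] [IsLocalRing R] {m n : ℕ}
    (G : Subgroup
      (Matrix.GeneralLinearGroup (Fin m) R × Matrix.GeneralLinearGroup (Fin n) R))
    (A : Matrix (Fin m) (Fin n) R) : Prop :=
  ∃ k : ℕ, IsDetermined G k A

/-- The ideal `I_j(A)` generated by the `j × j` minors of `A`. -/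
def minorIdeal {R : Type*} [CommRing R] {m n : ℕ} (j : ℕ)
    (A : Matrix (Fin m) (Fin n) R) : Ideal R :=
  Ideal.span {d | ∃ (r : Fin j ↪o Fin m) (c : Fin j ↪o Fin n), d = (A.submatrix r c).det}

end FiniteDeterminacy

namespace FiniteDeterminacy

open IsLocalRing Matrix

variable {R : Type*} [CommRing R] {m n : ℕ}

/-! Parts 2 and 3 form one cycle: two-sided determinacy puts a power of the maximal ideal in
`minorIdeal m A` (`exists_pow_le_minorIdeal`), which gives right determinacy
(`isFinitelyDetermined_gr_of_pow_le`), which is a special case of two-sided determinacy. For the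
first arrow, maximal minors of every `U * A * V` stay in the minor ideal; perturbing one maximal
block by `x ^ j` turns its minor into a characteristic polynomial value, and such a polynomial
cannot vanish at infinitely many points modulo a prime. For the second, Cramer's rule solves `A * X
= B` with `X` small, so `A + B = A * (1 + X)`. Part 1 uses a kernel vector of `A` modulo a prime. -/

theorem mem_orbit_Glr_iff {A B : Matrix (Fin m) (Fin n) R} :
    B ∈ MulAction.orbit (Glr R m n) A ↔
      ∃ (U : GeneralLinearGroup (Fin m) R) (V : GeneralLinearGroup (Fin n) R),
        (U : Matrix (Fin m) (Fin m) R) * A * (V : Matrix (Fin n) (Fin n) R) = B := by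
  constructor
  · rintro ⟨⟨⟨U, V⟩, _⟩, h⟩
    exact ⟨U, V⁻¹, h⟩
  · rintro ⟨U, V, h⟩
    refine ⟨⟨(U, V⁻¹), trivial⟩, ?_⟩
    change (U : Matrix (Fin m) (Fin m) R) * A *
      ((V⁻¹⁻¹ : GeneralLinearGroup (Fin n) R) : Matrix (Fin n) (Fin n) R) = B
    rw [inv_inv, h]

theorem mem_orbit_Gr_iff {A B : Matrix (Fin m) (Fin n) R} :
    B ∈ MulAction.orbit (Gr R m n) A ↔
      ∃ V : GeneralLinearGroup (Fin n) R, A * (V : Matrix (Fin n) (Fin n) R) = B := by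
  constructor
  · rintro ⟨⟨⟨U, V⟩, hU, _⟩, h⟩
    obtain rfl : U = 1 := hU
    refine ⟨V⁻¹, ?_⟩
    rw [← h]
    change A * _ = (1 : Matrix (Fin m) (Fin m) R) * A * _
    rw [Matrix.one_mul]
  · rintro ⟨V, h⟩
    refine ⟨⟨(1, V⁻¹), rfl, trivial⟩, ?_⟩
    change (1 : Matrix (Fin m) (Fin m) R) * A *
      ((V⁻¹⁻¹ : GeneralLinearGroup (Fin n) R) : Matrix (Fin n) (Fin n) R) = B
    rw [inv_inv, Matrix.one_mul, h]

theorem mem_orbit_Gl_iff {A B : Matrix (Fin m) (Fin n) R} :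
    B ∈ MulAction.orbit (Gl R m n) A ↔
      ∃ U : GeneralLinearGroup (Fin m) R, (U : Matrix (Fin m) (Fin m) R) * A = B := by
  constructor
  · rintro ⟨⟨⟨U, V⟩, _, hV⟩, h⟩
    obtain rfl : V = 1 := hV
    refine ⟨U, ?_⟩
    rw [← h]
    change _ = (U : Matrix (Fin m) (Fin m) R) * A *
      ((1⁻¹ : GeneralLinearGroup (Fin n) R) : Matrix (Fin n) (Fin n) R)
    rw [inv_one, Units.val_one, Matrix.mul_one]
  · rintro ⟨U, h⟩
    refine ⟨⟨(U, 1), trivial, rfl⟩, ?_⟩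
    change (U : Matrix (Fin m) (Fin m) R) * A *
      ((1⁻¹ : GeneralLinearGroup (Fin n) R) : Matrix (Fin n) (Fin n) R) = B
    rw [inv_one, Units.val_one, Matrix.mul_one, h]

/-- Finite right determinacy implies finite two-sided determinacy. -/
theorem IsFinitelyDetermined.glr_of_gr [IsLocalRing R] {A : Matrix (Fin m) (Fin n) R}
    (h : IsFinitelyDetermined (Gr R m n) A) : IsFinitelyDetermined (Glr R m n) A := by
  obtain ⟨k, hk⟩ := h
  refine ⟨k, fun B hB => ?_⟩
  obtain ⟨V, hV⟩ := mem_orbit_Gr_iff.1 (hk B hB)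
  exact mem_orbit_Glr_iff.2 ⟨1, V, by rw [Units.val_one, Matrix.one_mul, hV]⟩

/-! ### Maximal minors -/

/-- Generators use increasing column choices: sorting `f` costs a sign, and a repeated column gives
zero. -/
theorem det_submatrix_mem_minorIdeal (A : Matrix (Fin m) (Fin n) R) (f : Fin m → Fin n) :
    (A.submatrix id f).det ∈ minorIdeal m A := by
  by_cases hf : Function.Injective f
  · have hmono : StrictMono (f ∘ Tuple.sort f) :=
      (Tuple.monotone_sort f).strictMono_of_injective (hf.comp (Tuple.sort f).injective)
    have hmem : (A.submatrix id (f ∘ Tuple.sort f)).det ∈ minorIdeal m A :=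
      Ideal.subset_span ⟨RelEmbedding.refl _, OrderEmbedding.ofStrictMono _ hmono, rfl⟩
    have hsign : (A.submatrix id (f ∘ Tuple.sort f)).det =
        Equiv.Perm.sign (Tuple.sort f) * (A.submatrix id f).det :=
      Matrix.det_permute' (Tuple.sort f) (A.submatrix id f)
    rw [hsign] at hmem
    rcases Int.units_eq_one_or (Equiv.Perm.sign (Tuple.sort f)) with h | h <;>
      simpa [h] using hmem
  · simp only [Function.Injective, not_forall] at hf
    obtain ⟨i, j, hij, hne⟩ := hf
    rw [Matrix.det_zero_of_column_eq hne (fun k => by simp [hij])]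
    exact Ideal.zero_mem _

/-- The easy half of Cauchy–Binet: expand the determinant multilinearly in the columns of `A * W`.
-/
theorem det_mul_mem_minorIdeal (A : Matrix (Fin m) (Fin n) R) (W : Matrix (Fin n) (Fin m) R) :
    (A * W).det ∈ minorIdeal m A := by
  have hrow : (A * W)ᵀ = fun i => ∑ k, W k i • Aᵀ k := by
    ext i j
    simp [Matrix.mul_apply, Finset.sum_apply, mul_comm]
  have hexp : (A * W)ᵀ.det =
      ∑ f : Fin m → Fin n, (∏ i, W (f i) i) • (A.submatrix id f)ᵀ.det := by
    rw [hrow]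
    have h := (Matrix.detRowAlternating (n := Fin m) (R := R)).toMultilinearMap.map_sum
      (fun i k => W k i • Aᵀ k)
    refine h.trans (Finset.sum_congr rfl fun f _ => ?_)
    exact MultilinearMap.map_smul_univ _ _ _
  rw [← Matrix.det_transpose, hexp]
  refine Ideal.sum_mem _ fun f _ => ?_
  rw [Matrix.det_transpose, smul_eq_mul]
  exact Ideal.mul_mem_left _ _ (det_submatrix_mem_minorIdeal A f)

/-- An element of the ideal of maximal minors gives a right inverse up to that scalar. -/
theorem exists_mul_eq_smul_one {A : Matrix (Fin m) (Fin n) R} {x : R}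
    (hx : x ∈ minorIdeal m A) :
    ∃ C : Matrix (Fin n) (Fin m) R, A * C = x • (1 : Matrix (Fin m) (Fin m) R) := by
  refine Submodule.span_induction ?_ ⟨0, by simp⟩ ?_ ?_ hx
  · rintro _ ⟨r, c, rfl⟩
    have hr : (A.submatrix r c).det • (1 : Matrix (Fin m) (Fin m) R) =
        (A.submatrix r c * (A.submatrix r c).adjugate) := (Matrix.mul_adjugate _).symm
    have hbij : Function.Bijective r := Finite.injective_iff_bijective.1 r.injective
    let e : Fin m ≃ Fin m := Equiv.ofBijective r hbij
    -- The adjugate is spread over the rows picked by `c`; `e.symm` undoes the row relabelling by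
    -- `r`.
    refine ⟨(1 : Matrix (Fin n) (Fin n) R).submatrix id c *
      (A.submatrix r c).adjugate.submatrix id e.symm, ?_⟩
    rw [← Matrix.mul_assoc]
    have hA : A * (1 : Matrix (Fin n) (Fin n) R).submatrix id c =
        (A.submatrix r c).submatrix e.symm id := by
      ext i j
      have : r (e.symm i) = i := e.apply_symm_apply i
      simp [Matrix.mul_apply, Matrix.one_apply, this]
    rw [hA, ← Matrix.submatrix_mul _ _ e.symm id e.symm Function.bijective_id, ← hr]
    ext i j
    simp [Matrix.one_apply]
  · rintro x y _ _ ⟨C, hC⟩ ⟨D, hD⟩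
    exact ⟨C + D, by rw [Matrix.mul_add, hC, hD, add_smul]⟩
  · rintro a x _ ⟨C, hC⟩
    exact ⟨a • C, by rw [Matrix.mul_smul, hC, smul_smul, smul_eq_mul]⟩

/-- A column with entries in `J * I_m(A)` is `A` times a column with entries in `J`. -/
theorem exists_mulVec_single_eq {A : Matrix (Fin m) (Fin n) R} {J : Ideal R} {b : R}
    (hb : b ∈ J * minorIdeal m A) (i : Fin m) :
    ∃ v : Fin n → R, (∀ l, v l ∈ J) ∧ A *ᵥ v = Pi.single i b := by
  refine Submodule.mul_induction_on hb ?_ ?_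
  · intro y hy x hx
    obtain ⟨C, hC⟩ := exists_mul_eq_smul_one hx
    refine ⟨y • C.col i, fun l => Ideal.mul_mem_right _ _ hy, ?_⟩
    have h : A *ᵥ C.col i = (A * C).col i := by
      ext l; simp [Matrix.mul_apply, Matrix.mulVec, dotProduct]
    rw [Matrix.mulVec_smul, h, hC]
    ext l
    simp [Matrix.one_apply, Pi.single_apply]
  · rintro x y ⟨v, hv, hvx⟩ ⟨w, hw, hwy⟩
    exact ⟨v + w, fun l => Ideal.add_mem _ (hv l) (hw l), by
      rw [Matrix.mulVec_add, hvx, hwy, Pi.single_add]⟩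

theorem exists_mul_eq {A B : Matrix (Fin m) (Fin n) R} {J : Ideal R}
    (hB : B ∈ matOver m n (J * minorIdeal m A)) :
    ∃ X ∈ matOver n n J, A * X = B := by
  choose v hv hAv using fun i j => exists_mulVec_single_eq (hB i j) i
  refine ⟨Matrix.of fun l j => ∑ i, v i j l, fun l j => Ideal.sum_mem _ fun i _ => hv i j l, ?_⟩
  ext i j
  have h : (A * Matrix.of fun l j => ∑ i, v i j l) i j = (∑ i', A *ᵥ v i' j) i := by
    rw [← Matrix.mulVec_sum]
    simp [Matrix.mul_apply, Matrix.mulVec, dotProduct, Finset.sum_apply]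
  rw [h, Finset.sum_apply]
  simp [hAv, Pi.single_apply]

theorem isUnit_one_add [IsLocalRing R] {X : Matrix (Fin n) (Fin n) R}
    (hX : X ∈ matOver n n (maximalIdeal R)) : IsUnit (1 + X) := by
  rw [Matrix.isUnit_iff_isUnit_det]
  refine isUnit_of_map_unit (residue R) _ ?_
  have h : (residue R).mapMatrix (1 + X) = 1 := by
    rw [map_add, map_one, add_eq_left]
    ext i j
    exact (residue_eq_zero_iff _).2 (hX i j)
  rw [RingHom.map_det, h, Matrix.det_one]
  exact isUnit_one

theorem isFinitelyDetermined_gr_of_pow_le [IsLocalRing R] {A : Matrix (Fin m) (Fin n) R} {N : ℕ}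
    (hN : maximalIdeal R ^ N ≤ minorIdeal m A) : IsFinitelyDetermined (Gr R m n) A := by
  refine ⟨N, fun B hB => ?_⟩
  -- The extra factor of the maximal ideal goes into `X`, making `1 + X` invertible.
  have hle : maximalIdeal R ^ (N + 1) ≤ maximalIdeal R * minorIdeal m A := by
    rw [pow_succ']
    exact Ideal.mul_mono_right hN
  obtain ⟨X, hX, hAX⟩ := exists_mul_eq (A := A) (B := B) (J := maximalIdeal R)
    fun i j => hle (hB i j)
  obtain ⟨V, hV⟩ := isUnit_one_add hX
  exact mem_orbit_Gr_iff.2 ⟨V, by rw [hV, Matrix.mul_add, Matrix.mul_one, hAX]⟩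

/-- If `det (M + x ^ j)` lies in a prime ideal for all large `j`, then so does `x`, provided
that `x` is not a unit of the local ring. -/
theorem mem_prime_of_det_add_pow_mem [IsLocalRing R] {p : Ideal R} [p.IsPrime]
    {M : Matrix (Fin m) (Fin m) R} {x : R} (hx : x ∈ maximalIdeal R) {k : ℕ}
    (h : ∀ j, k < j → (M + Matrix.scalar (Fin m) (x ^ j)).det ∈ p) : x ∈ p := by
  by_contra hxp
  let f := Ideal.Quotient.mk p
  have hx0 : f x ≠ 0 := fun h0 => hxp (Ideal.Quotient.eq_zero_iff_mem.1 h0)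
  have hxu : ¬ IsUnit (f x) := by
    rintro hu
    obtain ⟨z, hz⟩ := hu.exists_right_inv
    obtain ⟨y, rfl⟩ := Ideal.Quotient.mk_surjective z
    rw [← map_mul, ← map_one f, Ideal.Quotient.eq] at hz
    have h1 := (le_maximalIdeal (Ideal.IsPrime.ne_top ‹_›)) hz
    refine (maximalIdeal.isMaximal R).ne_top ((Ideal.eq_top_iff_one _).2 ?_)
    simpa using Ideal.sub_mem _ (Ideal.mul_mem_right y _ hx) h1
  -- In the domain `R ⧸ p`, powers of a nonzero nonunit are distinct.
  have hpow : Function.Injective fun j : ℕ => f x ^ j :=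
    fun _ _ h => (pow_inj_of_not_isUnit hxu hx0).1 h
  -- The determinant is the characteristic polynomial of `-M` at `x ^ j`.
  have hroot : ∀ j, k < j → (((-M).charpoly).map f).IsRoot (f x ^ j) := by
    intro j hj
    rw [Polynomial.IsRoot, ← map_pow, Polynomial.eval_map_apply, Matrix.eval_charpoly,
      sub_neg_eq_add, add_comm]
    exact Ideal.Quotient.eq_zero_iff_mem.2 (h j hj)
  refine ((Matrix.charpoly_monic (-M)).map f).ne_zero
    (Polynomial.eq_zero_of_infinite_isRoot _ ?_)
  refine ((Set.Ioi_infinite k).image hpow.injOn).mono ?_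
  rintro _ ⟨j, hj, rfl⟩
  exact hroot j hj

theorem exists_pow_le_minorIdeal [IsLocalRing R] [IsNoetherianRing R] (hmn : m ≤ n)
    {A : Matrix (Fin m) (Fin n) R} (hA : IsFinitelyDetermined (Glr R m n) A) :
    ∃ N : ℕ, maximalIdeal R ^ N ≤ minorIdeal m A := by
  obtain ⟨k, hk⟩ := hA
  refine Ideal.exists_pow_le_of_le_radical_of_fg ?_ (IsNoetherian.noetherian _)
  intro x hx
  rw [Ideal.radical_eq_sInf, Submodule.mem_sInf]
  rintro p ⟨hle, hp⟩
  refine mem_prime_of_det_add_pow_mem (M := A.submatrix id (Fin.castLE hmn)) hx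
    (k := k) fun j hj => hle ?_
  let c := Fin.castLE hmn
  -- `E` is the block matrix `(1 | 0)`.
  let E : Matrix (Fin m) (Fin n) R := (1 : Matrix (Fin n) (Fin n) R).submatrix c id
  have hE : E.submatrix id c = 1 := by
    rw [Matrix.submatrix_submatrix]
    exact Matrix.submatrix_one c (Fin.castLE_injective hmn)
  obtain ⟨U, V, hUV⟩ := mem_orbit_Glr_iff.1 (hk (x ^ j • E) fun a b =>
    Ideal.mul_mem_right _ _ (Ideal.pow_le_pow_right hj (Ideal.pow_mem_pow hx j)))
  have hsub : A.submatrix id c + Matrix.scalar (Fin m) (x ^ j) =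
      (U : Matrix (Fin m) (Fin m) R) * (A * (V : Matrix (Fin n) (Fin n) R).submatrix id c) := by
    have h := congrArg (fun M => M.submatrix id c) hUV
    simp only [Matrix.submatrix_add, Matrix.submatrix_smul, Pi.add_apply, Pi.smul_apply, hE] at h
    rw [Matrix.scalar_apply, ← Matrix.smul_one_eq_diagonal, ← Matrix.mul_assoc]
    exact h.symm
  rw [hsub, Matrix.det_mul]
  exact Ideal.mul_mem_left _ _ (det_mul_mem_minorIdeal A _)

/-- Left multiplications preserve kernels, so finite left determinacy with `m < n` forces every
prime ideal to be maximal. -/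
theorem maximalIdeal_le_of_isFinitelyDetermined_gl [IsLocalRing R] (hm : 1 ≤ m) (hmn : m < n)
    {A : Matrix (Fin m) (Fin n) R} (hA : IsFinitelyDetermined (Gl R m n) A)
    (p : Ideal R) [p.IsPrime] : maximalIdeal R ≤ p := by
  obtain ⟨k, hk⟩ := hA
  refine (Ideal.IsPrime.pow_le_iff k.succ_ne_zero).1 fun b hb => ?_
  let f := Ideal.Quotient.mk p
  have hker : ¬ Function.Injective (A.map f).mulVecLin := fun h =>
    hmn.not_ge (le_of_fin_injective (R ⧸ p) _ h)
  rw [← LinearMap.ker_eq_bot, ← ne_eq, Submodule.ne_bot_iff] at hker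
  obtain ⟨v, hv, hv0⟩ := hker
  rw [LinearMap.mem_ker, Matrix.mulVecLin_apply] at hv
  obtain ⟨j, hj⟩ := Function.ne_iff.1 hv0
  let i : Fin m := ⟨0, hm⟩
  -- Column `j` is chosen with `v j ≠ 0`: modulo `p`, `U * A` kills `v`, while the perturbed matrix
  -- sends it to `b * v j` in row `i`.
  obtain ⟨U, hU⟩ := mem_orbit_Gl_iff.1 (hk (Matrix.single i j b) fun a c => by
    rw [Matrix.single_apply]
    split_ifs
    exacts [hb, Ideal.zero_mem _])
  have h := congrArg (fun M => (M.map f *ᵥ v) i) hU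
  simp only [Matrix.map_mul, ← Matrix.mulVec_mulVec, hv, Matrix.mulVec_zero,
    Matrix.map_add f (map_add f), Matrix.add_mulVec, zero_add] at h
  have hbv : f b * v j = 0 := by
    simpa [Matrix.mulVec, dotProduct, Matrix.single_apply, apply_ite f, ite_and] using h.symm
  exact Ideal.Quotient.eq_zero_iff_mem.1 ((mul_eq_zero.1 hbv).resolve_right hj)

theorem not_isFinitelyDetermined_gl [IsLocalRing R] (hdim : 0 < ringKrullDim R) (hm : 1 ≤ m)
    (hmn : m < n) (A : Matrix (Fin m) (Fin n) R) : ¬ IsFinitelyDetermined (Gl R m n) A := by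
  intro hA
  have : Ring.KrullDimLE 0 R := Ring.krullDimLE_zero_iff.2 fun p hp => by
    have h := maximalIdeal_le_of_isFinitelyDetermined_gl hm hmn hA p
    rw [← le_antisymm h (le_maximalIdeal hp.ne_top)]
    infer_instance
  exact hdim.not_ge Order.KrullDimLE.krullDim_le

end FiniteDeterminacy

theorem mainTheorem3 {𝕜 : Type*} [Field 𝕜] [CharZero 𝕜]
    {R : Type*} [CommRing R] [IsLocalRing R] [IsNoetherianRing R] [Algebra 𝕜 R]
    (m n : ℕ) (hm : 1 ≤ m) (hmn : m ≤ n) :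
    (0 < ringKrullDim R → m < n →
      ∀ A ∈ FiniteDeterminacy.matOver m n (IsLocalRing.maximalIdeal R),
        ¬ FiniteDeterminacy.IsFinitelyDetermined (FiniteDeterminacy.Gl R m n) A) ∧
    (∀ A ∈ FiniteDeterminacy.matOver m n (IsLocalRing.maximalIdeal R),
      (FiniteDeterminacy.IsFinitelyDetermined (FiniteDeterminacy.Glr R m n) A ↔
        FiniteDeterminacy.IsFinitelyDetermined (FiniteDeterminacy.Gr R m n) A)) ∧
    (∀ A ∈ FiniteDeterminacy.matOver m n (IsLocalRing.maximalIdeal R),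
      (FiniteDeterminacy.IsFinitelyDetermined (FiniteDeterminacy.Gr R m n) A ↔
        ∃ N : ℕ, IsLocalRing.maximalIdeal R ^ N ≤ FiniteDeterminacy.minorIdeal m A)) := by
  have key : ∀ A : Matrix (Fin m) (Fin n) R,
      FiniteDeterminacy.IsFinitelyDetermined (FiniteDeterminacy.Glr R m n) A →
        FiniteDeterminacy.IsFinitelyDetermined (FiniteDeterminacy.Gr R m n) A := fun A hA =>
    let ⟨_, hN⟩ := FiniteDeterminacy.exists_pow_le_minorIdeal hmn hA
    FiniteDeterminacy.isFinitelyDetermined_gr_of_pow_le hN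
  exact ⟨fun hdim hlt A _ => FiniteDeterminacy.not_isFinitelyDetermined_gl hdim hm hlt A,
    fun A _ => ⟨key A, fun h => h.glr_of_gr⟩,
    fun A _ => ⟨fun h => FiniteDeterminacy.exists_pow_le_minorIdeal hmn h.glr_of_gr,
      fun ⟨_, hN⟩ => FiniteDeterminacy.isFinitelyDetermined_gr_of_pow_le hN⟩⟩
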